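/- Let $q$ be a prime power, $F=F(q)$ the field with $q$ elements, and $T=T_3(q)$ the ring of lower triangular $3\times 3$ matrices over $F$. Let ${}^2T$ be the free left $T$-module of pairs $(X,Y)$ with $X=(x_{ij}),Y=(y_{ij})\in T$. The cyclic submodule $T(X,Y)=\{(AX,AY):A\in T\}$ is called free if $(AX,AY)=(0,0)$ implies $A=0$. A pair $(X,Y)$ is unimodular if, for each $i=1,2,3$, $x_{ii}\neq 0$ or $y_{ii}\neq 0$; the points of the projective line over $T$ are the submodules $T(X,Y)$ with $(X,Y)$ unimodular. An outlier is a pair in ${}^2T$ that is contained in no point of the projective line. There are exactly $(q+1)^2(2q^2+q+1)$ free cyclic submodules of ${}^2T$ generated by outliers. The set of these submodules is the disjoint union of $q+1$ sets, namely the first set and the $q$ $k$-sets, $k\in F$, described as follows. Write $$[a\,|\,b,c\,|\,d,e,f]=\begin{pmatrix}a&0&0\\ b&c&0\\ d&e&f\end{pmatrix}.$$ The first set consists of the submodules generated by the pairs 1. $([1|0,0|0,x_{32},1],\ [0|1,0|0,y_{32},y_{33}])$, 2. $([1|0,0|0,x_{32},0],\ [0|1,0|0,y_{32},1])$, 3.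 $([1|0,0|0,x_{32},0],\ [0|1,0|0,1,0])$, 4. $([1|0,0|0,1,0],\ [0|1,0|0,0,0])$, 5. $([1|0,1|0,0,0],\ [0|y_{21},y_{22}|y_{31},1,0])$, 6. $([1|0,1|0,0,0],\ [0|y_{21},y_{22}|1,0,0])$, 7. $([1|0,0|0,1,0],\ [0|y_{21},1|y_{31},0,0])$, 8. $([1|0,0|0,0,0],\ [0|y_{21},1|1,0,0])$, where $x_{32},y_{21},y_{22},y_{31},y_{32},y_{33}\in F$. For $k\in F$, the $k$-set consists of the submodules generated by the pairs 1. $([k|1,0|0,x_{32},x_{33}],\ [1|0,0|0,y_{32},1])$, 2. $([k|1,0|0,x_{32},1],\ [1|0,0|0,y_{32},0])$, 3. $([k|1,0|0,1,0],\ [1|0,0|0,y_{32},0])$, 4. $([k|1,0|0,0,0],\ [1|0,0|0,1,0])$, 5. $([k|x_{21},x_{22}|x_{31},1,0],\ [1|0,1|0,0,0])$, 6. $([k|x_{21},x_{22}|1,0,0],\ [1|0,1|0,0,0])$, 7. $([k|x_{21},1|x_{31},0,0],\ [1|0,0|0,1,0])$, 8. $([k|x_{21},1|1,0,0],\ [1|0,0|0,0,0])$,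 where $x_{21},x_{22},x_{31},x_{32},x_{33},y_{32}\in F$. The submodules listed are pairwise distinct: within the first set and within each $k$-set, different families, or different values of the parameters occurring in one family, give different submodules. -/

import Mathlib

/-- The ring `T_n(F)` of lower triangular `n × n` matrices with entries in `F`. -/
def lowerTriangular (n : ℕ) (F : Type*) [Field F] : Subring (Matrix (Fin n) (Fin n) F) where
  carrier := {M | ∀ i j, i < j → M i j = 0}
  mul_mem' := by
    intro A B hA hB i j hij
    rw [Matrix.mul_apply]
    refine Finset.sum_eq_zero fun l _ => ?_
    rcases lt_or_ge i l with h | h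
    · rw [hA i l h, zero_mul]
    · rw [hB l j (lt_of_le_of_lt h hij), mul_zero]
  one_mem' := fun _ _ hij => Matrix.one_apply_ne hij.ne
  add_mem' := by
    intro A B hA hB i j hij
    rw [Matrix.add_apply, hA i j hij, hB i j hij, add_zero]
  zero_mem' := fun _ _ _ => rfl
  neg_mem' := by
    intro A hA i j hij
    rw [Matrix.neg_apply, hA i j hij, neg_zero]

/-- Pairs of lower triangular matrices: the free left module `²T_n(F)` over `T_n(F)`. -/
abbrev TriPair (n : ℕ) (F : Type*) [Field F] : Type _ :=
  lowerTriangular n F × lowerTriangular n F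

/-- The left cyclic submodule `T_n(F)(X, Y) = {(AX, AY) : A ∈ T_n(F)}`. -/
def cyclicSubmodule {n : ℕ} {F : Type*} [Field F] (p : TriPair n F) :
    Submodule (lowerTriangular n F) (TriPair n F) :=
  Submodule.span (lowerTriangular n F) {p}

/-- The pair `(X, Y)` generates a free cyclic submodule: `(AX, AY) = (0, 0)` only for `A = 0`. -/
def GeneratesFree {n : ℕ} {F : Type*} [Field F] (p : TriPair n F) : Prop :=
  ∀ A : lowerTriangular n F, (A * p.1, A * p.2) = (0, 0) → A = 0

/-- The pair `(X, Y)` is unimodular: `x_ii ≠ 0` or `y_ii ≠ 0` for every `i`. -/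
def IsUnimodularPair {n : ℕ} {F : Type*} [Field F] (p : TriPair n F) : Prop :=
  ∀ i : Fin n, p.1.1 i i ≠ 0 ∨ p.2.1 i i ≠ 0

/-- The projective line over `T_n(F)`; its points are the cyclic submodules generated by
unimodular pairs. -/
def projectiveLine (n : ℕ) (F : Type*) [Field F] :
    Set (Submodule (lowerTriangular n F) (TriPair n F)) :=
  {N | ∃ p : TriPair n F, IsUnimodularPair p ∧ N = cyclicSubmodule p}

/-- An outlier is a pair that is contained in no point of the projective line. -/
def IsOutlier {n : ℕ} {F : Type*} [Field F] (p : TriPair n F) : Prop :=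
  ∀ N ∈ projectiveLine n F, p ∉ N

/-- The free cyclic submodules of `²T_n(F)` generated by outliers. -/
def outlierFreeSubmodules (n : ℕ) (F : Type*) [Field F] :
    Set (Submodule (lowerTriangular n F) (TriPair n F)) :=
  {N | ∃ p : TriPair n F, IsOutlier p ∧ GeneratesFree p ∧ N = cyclicSubmodule p}

/-- The lower triangular `3 × 3` matrix with the given entries, row by row. -/
def tri {F : Type*} [Field F] (a b c d e f : F) : lowerTriangular 3 F :=
  ⟨!![a, 0, 0;
      b, c, 0;
      d, e, f], by
    intro i j hij
    fin_cases i <;> fin_cases j <;> first | rfl | exact absurd hij (by decide)⟩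

/-- Labels for the pairs listed in the first set: eight families with their parameters. -/
inductive FirstIndex (F : Type*)
  | fam1 (x32 y32 y33 : F)
  | fam2 (x32 y32 : F)
  | fam3 (x32 : F)
  | fam4
  | fam5 (y21 y22 y31 : F)
  | fam6 (y21 y22 : F)
  | fam7 (y21 y31 : F)
  | fam8 (y21 : F)

/-- Labels for the pairs listed in a `k`-set: eight families with their parameters. -/
inductive KIndex (F : Type*)
  | fam1 (x32 x33 y32 : F)
  | fam2 (x32 y32 : F)
  | fam3 (y32 : F)
  | fam4
  | fam5 (x21 x22 x31 : F)
  | fam6 (x21 x22 : F)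
  | fam7 (x21 x31 : F)
  | fam8 (x21 : F)

/-- The pairs listed in the first set. -/
def firstPair {F : Type*} [Field F] : FirstIndex F → TriPair 3 F
  | .fam1 x32 y32 y33 =>
      (tri 1
           0 0
           0 x32 1,
       tri 0
           1 0
           0 y32 y33)
  | .fam2 x32 y32 =>
      (tri 1
           0 0
           0 x32 0,
       tri 0
           1 0
           0 y32 1)
  | .fam3 x32 =>
      (tri 1
           0 0
           0 x32 0,
       tri 0
           1 0
           0 1 0)
  | .fam4 =>
      (tri 1
           0 0
           0 1 0,
       tri 0
           1 0
           0 0 0)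
  | .fam5 y21 y22 y31 =>
      (tri 1
           0 1
           0 0 0,
       tri 0
           y21 y22
           y31 1 0)
  | .fam6 y21 y22 =>
      (tri 1
           0 1
           0 0 0,
       tri 0
           y21 y22
           1 0 0)
  | .fam7 y21 y31 =>
      (tri 1
           0 0
           0 1 0,
       tri 0
           y21 1
           y31 0 0)
  | .fam8 y21 =>
      (tri 1
           0 0
           0 0 0,
       tri 0
           y21 1
           1 0 0)

/-- The pairs listed in the `k`-set. -/
def kPair {F : Type*} [Field F] (k : F) : KIndex F → TriPair 3 F
  | .fam1 x32 x33 y32 =>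
      (tri k
           1 0
           0 x32 x33,
       tri 1
           0 0
           0 y32 1)
  | .fam2 x32 y32 =>
      (tri k
           1 0
           0 x32 1,
       tri 1
           0 0
           0 y32 0)
  | .fam3 y32 =>
      (tri k
           1 0
           0 1 0,
       tri 1
           0 0
           0 y32 0)
  | .fam4 =>
      (tri k
           1 0
           0 0 0,
       tri 1
           0 0
           0 1 0)
  | .fam5 x21 x22 x31 =>
      (tri k
           x21 x22
           x31 1 0,
       tri 1
           0 1
           0 0 0)
  | .fam6 x21 x22 =>
      (tri k
           x21 x22
           1 0 0,
       tri 1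
           0 1
           0 0 0)
  | .fam7 x21 x31 =>
      (tri k
           x21 1
           x31 0 0,
       tri 1
           0 0
           0 1 0)
  | .fam8 x21 =>
      (tri k
           x21 1
           1 0 0,
       tri 1
           0 0
           0 0 0)

/-- The first set of submodules. -/
def firstSet (F : Type*) [Field F] : Set (Submodule (lowerTriangular 3 F) (TriPair 3 F)) :=
  Set.range fun t : FirstIndex F => cyclicSubmodule (firstPair t)

/-- The `k`-set of submodules. -/
def kSet {F : Type*} [Field F] (k : F) :
    Set (Submodule (lowerTriangular 3 F) (TriPair 3 F)) :=
  Set.range fun t : KIndex F => cyclicSubmodule (kPair k t)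

/-! For a pair generating a free submodule, being an outlier is the same as not being unimodular
(`mem_outlierFreeSubmodules_iff`), so the task is to classify such pairs up to left multiplication
by invertible matrices, i.e. by downward row reduction. Freeness makes the first row `(x11, y11)`
nonzero; its point on the projective line over `F` is an invariant and splits the submodules into `q
+ 1` classes. After clearing a column below this pivot, non-unimodularity forces the second or the
third diagonal position to vanish in both matrices, and reducing the last two rows yields the eight
families (`exists_firstPair_eq`, `exists_kPair_eq`). Comparing entries shows that the normal forms
are inequivalent, and counting parameters finishes. -/

section Triangular

variable {F : Type*} [Field F]

/-! ### Arithmetic of lower triangular matrices. -/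

theorem tri_mul_tri (a b c d e f a' b' c' d' e' f' : F) :
    tri a b c d e f * tri a' b' c' d' e' f' =
      tri (a * a') (b * a' + c * b') (c * c') (d * a' + e * b' + f * d') (e * c' + f * e')
        (f * f') := by
  apply Subtype.ext
  ext i j
  fin_cases i <;> fin_cases j <;>
    simp [tri, Matrix.mul_apply, Fin.sum_univ_three]

theorem tri_inj {a b c d e f a' b' c' d' e' f' : F} :
    tri a b c d e f = tri a' b' c' d' e' f' ↔
      a = a' ∧ b = b' ∧ c = c' ∧ d = d' ∧ e = e' ∧ f = f' := by
  constructor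
  · intro h
    have key : ∀ i j, (tri a b c d e f).1 i j = (tri a' b' c' d' e' f').1 i j := by
      rw [h]; simp
    exact ⟨key 0 0, key 1 0, key 1 1, key 2 0, key 2 1, key 2 2⟩
  · rintro ⟨rfl, rfl, rfl, rfl, rfl, rfl⟩
    rfl

theorem tri_zero : tri (0 : F) 0 0 0 0 0 = 0 := by
  apply Subtype.ext
  ext i j
  fin_cases i <;> fin_cases j <;> rfl

theorem tri_one : tri (1 : F) 0 1 0 0 1 = 1 := by
  apply Subtype.ext
  ext i j
  fin_cases i <;> fin_cases j <;> rfl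

theorem exists_eq_tri (A : lowerTriangular 3 F) : ∃ a b c d e f, A = tri a b c d e f := by
  refine ⟨A.1 0 0, A.1 1 0, A.1 1 1, A.1 2 0, A.1 2 1, A.1 2 2, ?_⟩
  apply Subtype.ext
  ext i j
  fin_cases i <;> fin_cases j <;> first | rfl | exact A.2 _ _ (by decide)

theorem smul_triPair (A X Y : lowerTriangular 3 F) : A • ((X, Y) : TriPair 3 F) = (A * X, A * Y) :=
  rfl

/-- A lower triangular matrix with nonzero diagonal entries has a left inverse. -/
theorem exists_tri_mul_eq_one {a b c d e f : F} (ha : a ≠ 0) (hc : c ≠ 0) (hf : f ≠ 0) :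
    ∃ B : lowerTriangular 3 F, B * tri a b c d e f = 1 := by
  refine ⟨tri a⁻¹ (-(b * a⁻¹ * c⁻¹)) c⁻¹ ((e * b * c⁻¹ - d) * a⁻¹ * f⁻¹) (-(e * c⁻¹ * f⁻¹)) f⁻¹, ?_⟩
  rw [tri_mul_tri, ← tri_one, tri_inj]
  refine ⟨?_, ?_, ?_, ?_, ?_, ?_⟩ <;> field_simp <;> ring

/-- A lower triangular matrix with a zero diagonal entry is annihilated from the left by a nonzero
matrix. -/
theorem exists_ne_zero_mul_tri_eq_zero {a b c d e f : F} (h : a = 0 ∨ c = 0 ∨ f = 0) :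
    ∃ B : lowerTriangular 3 F, B ≠ 0 ∧ B * tri a b c d e f = 0 := by
  simp only [← tri_zero]
  by_cases ha : a = 0
  · subst ha
    exact ⟨tri 1 0 0 0 0 0, by simp [tri_inj], by simp [tri_mul_tri]⟩
  by_cases hc : c = 0
  · subst hc
    -- The nonzero row consists of the cofactors of the last column of the upper left `2 × 2` block;
    -- the same device, for the full matrix, gives the witness when `f = 0`.
    refine ⟨tri 0 (-b) a 0 0 0, by simp [tri_inj, ha], ?_⟩
    simp only [tri_mul_tri, tri_inj]
    refine ⟨?_, ?_, ?_, ?_, ?_, ?_⟩ <;> ring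
  obtain rfl : f = 0 := by tauto
  refine ⟨tri 0 0 0 (e * b - c * d) (-(e * a)) (c * a), by simp [tri_inj, ha, hc], ?_⟩
  simp only [tri_mul_tri, tri_inj]
  refine ⟨?_, ?_, ?_, ?_, ?_, ?_⟩ <;> ring

/-! ### Cyclic submodules and their generators. -/

theorem cyclicSubmodule_smul {n : ℕ} {A B : lowerTriangular n F} (h : B * A = 1)
    (p : TriPair n F) : cyclicSubmodule (A • p) = cyclicSubmodule p := by
  apply le_antisymm
  · exact (Submodule.span_singleton_le_iff_mem _ _).2
      (Submodule.smul_mem _ _ (Submodule.mem_span_singleton_self p))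
  · refine (Submodule.span_singleton_le_iff_mem _ _).2 (Submodule.mem_span_singleton.2 ⟨B, ?_⟩)
    rw [smul_smul, h, one_smul]

theorem exists_tri_smul_of_cyclicSubmodule_eq {p p' : TriPair 3 F}
    (h : cyclicSubmodule p = cyclicSubmodule p') : ∃ a b c d e f : F, tri a b c d e f • p' = p := by
  have hp : p ∈ cyclicSubmodule p' := h ▸ Submodule.mem_span_singleton_self p
  obtain ⟨A, hA⟩ := Submodule.mem_span_singleton.1 hp
  obtain ⟨a, b, c, d, e, f, rfl⟩ := exists_eq_tri A
  exact ⟨a, b, c, d, e, f, hA⟩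

theorem generatesFree_iff {p : TriPair 3 F} :
    GeneratesFree p ↔ ∀ a b c d e f : F, tri a b c d e f • p = 0 →
      a = 0 ∧ b = 0 ∧ c = 0 ∧ d = 0 ∧ e = 0 ∧ f = 0 := by
  constructor
  · intro h a b c d e f hp
    have := h _ hp
    rwa [← tri_zero, tri_inj] at this
  · intro h A hA
    obtain ⟨a, b, c, d, e, f, rfl⟩ := exists_eq_tri A
    rw [← tri_zero, tri_inj]
    exact h _ _ _ _ _ _ hA

/-! ### Outliers and unimodularity. -/

theorem isUnimodularPair_tri {a b c d e f a' b' c' d' e' f' : F} :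
    IsUnimodularPair ((tri a b c d e f, tri a' b' c' d' e' f') : TriPair 3 F) ↔
      (a ≠ 0 ∨ a' ≠ 0) ∧ (c ≠ 0 ∨ c' ≠ 0) ∧ (f ≠ 0 ∨ f' ≠ 0) := by
  simp [IsUnimodularPair, Fin.forall_fin_succ, tri]

theorem IsOutlier.not_isUnimodularPair {n : ℕ} {p : TriPair n F} (h : IsOutlier p) :
    ¬ IsUnimodularPair p :=
  fun hp => h _ ⟨p, hp, rfl⟩ (Submodule.mem_span_singleton_self p)

/-- If `p = A • u` with `u` unimodular, a nonzero left annihilator of `A` would kill `p`. So `A` has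
nonzero diagonal, and the diagonal of `p` is that of `u` up to nonzero factors, making `p`
unimodular. -/
theorem GeneratesFree.isOutlier {p : TriPair 3 F} (h : GeneratesFree p)
    (hp : ¬ IsUnimodularPair p) : IsOutlier p := by
  rintro _ ⟨⟨X, Y⟩, hu, rfl⟩ hmem
  obtain ⟨A, rfl⟩ := Submodule.mem_span_singleton.1 hmem
  obtain ⟨a, b, c, d, e, f, rfl⟩ := exists_eq_tri A
  have hdiag : a ≠ 0 ∧ c ≠ 0 ∧ f ≠ 0 := by
    by_contra hcon
    obtain ⟨B, hB, hBA⟩ := exists_ne_zero_mul_tri_eq_zero (a := a) (b := b) (c := c) (d := d)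
      (e := e) (f := f) (by tauto)
    refine hB (h B ?_)
    change B • tri a b c d e f • ((X, Y) : TriPair 3 F) = 0
    rw [smul_smul, hBA, zero_smul]
  obtain ⟨ha, hc, hf⟩ := hdiag
  obtain ⟨x1, x2, x3, x4, x5, x6, rfl⟩ := exists_eq_tri X
  obtain ⟨y1, y2, y3, y4, y5, y6, rfl⟩ := exists_eq_tri Y
  rw [smul_triPair, tri_mul_tri, tri_mul_tri] at hp
  simp only [isUnimodularPair_tri, mul_ne_zero_iff, ne_eq, ha, hc, hf, not_false_eq_true, true_and]
    at hp hu
  exact hp hu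

theorem mem_outlierFreeSubmodules_iff {N : Submodule (lowerTriangular 3 F) (TriPair 3 F)} :
    N ∈ outlierFreeSubmodules 3 F ↔
      ∃ p : TriPair 3 F, ¬ IsUnimodularPair p ∧ GeneratesFree p ∧ N = cyclicSubmodule p :=
  ⟨fun ⟨p, ho, hf, hN⟩ => ⟨p, ho.not_isUnimodularPair, hf, hN⟩,
    fun ⟨p, hu, hf, hN⟩ => ⟨p, hf.isOutlier hu, hf, hN⟩⟩

/-! ### Admissibility and distinctness of the listed pairs. -/

theorem cyclicSubmodule_firstPair_mem (t : FirstIndex F) :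
    cyclicSubmodule (firstPair t) ∈ outlierFreeSubmodules 3 F := by
  refine mem_outlierFreeSubmodules_iff.2 ⟨_, ?_, generatesFree_iff.2 ?_, rfl⟩
  · cases t <;> simp [firstPair, isUnimodularPair_tri]
  · intro a b c d e f h
    cases t <;>
      simp only [firstPair, smul_triPair, tri_mul_tri, ← tri_zero, Prod.ext_iff, Prod.fst_zero,
        Prod.snd_zero, tri_inj] at h <;> grind

theorem cyclicSubmodule_kPair_mem (k : F) (t : KIndex F) :
    cyclicSubmodule (kPair k t) ∈ outlierFreeSubmodules 3 F := by
  refine mem_outlierFreeSubmodules_iff.2 ⟨_, ?_, generatesFree_iff.2 ?_, rfl⟩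
  · cases t <;> simp [kPair, isUnimodularPair_tri]
  · intro a b c d e f h
    cases t <;>
      simp only [kPair, smul_triPair, tri_mul_tri, ← tri_zero, Prod.ext_iff, Prod.fst_zero,
        Prod.snd_zero, tri_inj] at h <;> grind

/-- One membership suffices: if one listed pair is a left multiple of another, comparing entries
already forces the labels to agree. -/
theorem cyclicSubmodule_firstPair_injective :
    Function.Injective fun t : FirstIndex F => cyclicSubmodule (firstPair t) := by
  intro s t h
  obtain ⟨a, b, c, d, e, f, h⟩ := exists_tri_smul_of_cyclicSubmodule_eq h
  cases s <;> cases t <;>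
    simp only [firstPair, smul_triPair, tri_mul_tri, Prod.ext_iff, tri_inj] at h <;> grind

theorem cyclicSubmodule_kPair_injective (k : F) :
    Function.Injective fun t : KIndex F => cyclicSubmodule (kPair k t) := by
  intro s t h
  obtain ⟨a, b, c, d, e, f, h⟩ := exists_tri_smul_of_cyclicSubmodule_eq h
  cases s <;> cases t <;>
    simp only [kPair, smul_triPair, tri_mul_tri, Prod.ext_iff, tri_inj] at h <;> grind

/-- The top left entries of a left multiple are scaled by one common factor; this separates the `q +
1` sets. -/
theorem exists_mul_eq_of_cyclicSubmodule_eq {p p' : TriPair 3 F}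
    (h : cyclicSubmodule p = cyclicSubmodule p') :
    ∃ a : F, a * p'.1.1 0 0 = p.1.1 0 0 ∧ a * p'.2.1 0 0 = p.2.1 0 0 := by
  obtain ⟨a, b, c, d, e, f, rfl⟩ := exists_tri_smul_of_cyclicSubmodule_eq h
  exact ⟨a, by simp [tri, Matrix.mul_apply, Fin.sum_univ_three],
    by simp [tri, Matrix.mul_apply, Fin.sum_univ_three]⟩

theorem firstPair_apply_zero_zero (t : FirstIndex F) :
    (firstPair t).1.1 0 0 = 1 ∧ (firstPair t).2.1 0 0 = 0 := by
  cases t <;> exact ⟨rfl, rfl⟩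

theorem kPair_apply_zero_zero (k : F) (t : KIndex F) :
    (kPair k t).1.1 0 0 = k ∧ (kPair k t).2.1 0 0 = 1 := by
  cases t <;> exact ⟨rfl, rfl⟩

theorem disjoint_firstSet_kSet (k : F) : Disjoint (firstSet F) (kSet k) := by
  rw [Set.disjoint_left]
  rintro _ ⟨s, rfl⟩ ⟨t, h⟩
  obtain ⟨a, -, h2⟩ := exists_mul_eq_of_cyclicSubmodule_eq h
  simp [firstPair_apply_zero_zero, kPair_apply_zero_zero] at h2

theorem disjoint_kSet_kSet {k l : F} (hkl : k ≠ l) : Disjoint (kSet k) (kSet l) := by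
  rw [Set.disjoint_left]
  rintro _ ⟨s, rfl⟩ ⟨t, h⟩
  obtain ⟨a, h1, h2⟩ := exists_mul_eq_of_cyclicSubmodule_eq h
  simp only [kPair_apply_zero_zero, mul_one] at h1 h2
  rw [h2, one_mul] at h1
  exact hkl h1

/-! ### Row reduction to normal form. -/

theorem cyclicSubmodule_tri_smul {a b c d e f : F} (ha : a ≠ 0) (hc : c ≠ 0) (hf : f ≠ 0)
    (p : TriPair 3 F) : cyclicSubmodule (tri a b c d e f • p) = cyclicSubmodule p :=
  let ⟨_, hB⟩ := exists_tri_mul_eq_one ha hc hf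
  cyclicSubmodule_smul hB p

theorem GeneratesFree.tri_smul {a b c d e f : F} {p : TriPair 3 F} (hp : GeneratesFree p)
    (ha : a ≠ 0) (hc : c ≠ 0) (hf : f ≠ 0) : GeneratesFree (tri a b c d e f • p) := by
  rw [generatesFree_iff] at hp ⊢
  intro a' b' c' d' e' f' h
  rw [smul_smul, tri_mul_tri] at h
  have h' := hp _ _ _ _ _ _ h
  clear h hp
  grind

/-- If `x22 = y22 = 0`, row 2 clears `y31`, and the first nonzero entry among `x33, y33, y32, x32`
is scaled to 1: families 1 to 4. Otherwise row 3 has zero diagonal entries and is reduced by the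
pivot `x22` (families 5, 6) or, failing that, `y22` (families 7, 8). -/
theorem exists_firstPair_eq {x22 x32 x33 y21 y22 y31 y32 y33 : F}
    (hu : (x22 = 0 ∧ y22 = 0) ∨ (x33 = 0 ∧ y33 = 0))
    (hf : GeneratesFree ((tri 1 0 x22 0 x32 x33, tri 0 y21 y22 y31 y32 y33) : TriPair 3 F)) :
    cyclicSubmodule ((tri 1 0 x22 0 x32 x33, tri 0 y21 y22 y31 y32 y33) : TriPair 3 F) ∈
      firstSet F := by
  have h2 : ¬ (x22 = 0 ∧ y21 = 0 ∧ y22 = 0) := fun ⟨h, h', h''⟩ => by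
    subst h h' h''
    have := generatesFree_iff.1 hf 0 0 1 0 0 0
    simp [tri_mul_tri, tri_zero] at this
  -- Freeness in row 3: no combination of rows 2 and 3 that involves row 3 vanishes.
  have h3 : ∀ e f : F, e * x22 + f * x32 = 0 → f * x33 = 0 → e * y21 + f * y31 = 0 →
      e * y22 + f * y32 = 0 → f * y33 = 0 → f = 0 := fun e f e1 e2 e3 e4 e5 => by
    have := generatesFree_iff.1 hf 0 0 0 0 e f
    simp only [smul_triPair, tri_mul_tri, ← tri_zero, Prod.ext_iff, Prod.fst_zero,
      Prod.snd_zero, tri_inj] at this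
    grind
  have key : ∀ (c e f : F) (t : FirstIndex F), c ≠ 0 → f ≠ 0 →
      firstPair t = tri 1 0 c 0 e f •
        ((tri 1 0 x22 0 x32 x33, tri 0 y21 y22 y31 y32 y33) : TriPair 3 F) →
      cyclicSubmodule ((tri 1 0 x22 0 x32 x33, tri 0 y21 y22 y31 y32 y33) : TriPair 3 F) ∈
        firstSet F := fun c e f t hc hf h => by
    rw [← cyclicSubmodule_tri_smul one_ne_zero hc hf, ← h]
    exact ⟨t, rfl⟩
  simp only [smul_triPair, tri_mul_tri, Prod.ext_iff] at key
  rcases em (x22 = 0 ∧ y22 = 0) with ⟨rfl, rfl⟩ | h22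
  · have hy21 : y21 ≠ 0 := by tauto
    have h3' := h3 (-y31) y21
    by_cases hx33 : x33 = 0
    · by_cases hy33 : y33 = 0
      · by_cases hy32 : y32 = 0
        · have hx32 : x32 ≠ 0 := by grind
          refine key y21⁻¹ (-(y31 / y21 / x32)) x32⁻¹ .fam4 (by simpa) (by simpa) ?_
          simp only [firstPair, tri_inj]
          grind
        · refine key y21⁻¹ (-(y31 / y21 / y32)) y32⁻¹ (.fam3 (x32 / y32)) (by simpa) (by simpa) ?_
          simp only [firstPair, tri_inj]
          grind
      · refine key y21⁻¹ (-(y31 / y21 / y33)) y33⁻¹ (.fam2 (x32 / y33) (y32 / y33))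
          (by simpa) (by simpa) ?_
        simp only [firstPair, tri_inj]
        grind
    · refine key y21⁻¹ (-(y31 / y21 / x33)) x33⁻¹ (.fam1 (x32 / x33) (y32 / x33) (y33 / x33))
        (by simpa) (by simpa) ?_
      simp only [firstPair, tri_inj]
      grind
  · obtain ⟨rfl, rfl⟩ := hu.resolve_left h22
    by_cases hx22 : x22 = 0
    · subst hx22
      have hy22 : y22 ≠ 0 := by tauto
      have h3' := h3 (-y32) y22
      obtain ⟨u, hu⟩ : ∃ u, u = y31 - y32 / y22 * y21 := ⟨_, rfl⟩
      by_cases hx32 : x32 = 0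
      · have hu0 : u ≠ 0 := by grind
        refine key y22⁻¹ (-(y32 / y22 / u)) u⁻¹ (.fam8 (y21 / y22)) (by simpa) (by simpa) ?_
        simp only [firstPair, tri_inj]
        grind
      · refine key y22⁻¹ (-(y32 / y22 / x32)) x32⁻¹ (.fam7 (y21 / y22) (u / x32))
          (by simpa) (by simpa) ?_
        simp only [firstPair, tri_inj]
        grind
    · have h3' := h3 (-x32) x22
      -- `u` and `v` are what remains of `y31` and `y32` once `x32` is cleared.
      obtain ⟨u, hu⟩ : ∃ u, u = y31 - x32 / x22 * y21 := ⟨_, rfl⟩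
      obtain ⟨v, hv⟩ : ∃ v, v = y32 - x32 / x22 * y22 := ⟨_, rfl⟩
      by_cases hv0 : v = 0
      · have hu0 : u ≠ 0 := by grind
        refine key x22⁻¹ (-(x32 / x22 / u)) u⁻¹ (.fam6 (y21 / x22) (y22 / x22))
          (by simpa) (by simpa) ?_
        simp only [firstPair, tri_inj]
        grind
      · refine key x22⁻¹ (-(x32 / x22 / v)) v⁻¹ (.fam5 (y21 / x22) (y22 / x22) (u / v))
          (by simpa) (by simpa) ?_
        simp only [firstPair, tri_inj]
        grind

/-- The same reduction with the roles of the two matrices exchanged; `k` is untouched because row 1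
is kept fixed. -/
theorem exists_kPair_eq {k x21 x22 x31 x32 x33 y22 y32 y33 : F}
    (hu : (x22 = 0 ∧ y22 = 0) ∨ (x33 = 0 ∧ y33 = 0))
    (hf : GeneratesFree ((tri k x21 x22 x31 x32 x33, tri 1 0 y22 0 y32 y33) : TriPair 3 F)) :
    cyclicSubmodule ((tri k x21 x22 x31 x32 x33, tri 1 0 y22 0 y32 y33) : TriPair 3 F) ∈
      kSet k := by
  have h2 : ¬ (y22 = 0 ∧ x21 = 0 ∧ x22 = 0) := fun ⟨h, h', h''⟩ => by
    subst h h' h''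
    have := generatesFree_iff.1 hf 0 0 1 0 0 0
    simp [tri_mul_tri, tri_zero] at this
  have h3 : ∀ e f : F, e * y22 + f * y32 = 0 → f * y33 = 0 → e * x21 + f * x31 = 0 →
      e * x22 + f * x32 = 0 → f * x33 = 0 → f = 0 := fun e f e1 e2 e3 e4 e5 => by
    have := generatesFree_iff.1 hf 0 0 0 0 e f
    simp only [smul_triPair, tri_mul_tri, ← tri_zero, Prod.ext_iff, Prod.fst_zero,
      Prod.snd_zero, tri_inj] at this
    grind
  have key : ∀ (c e f : F) (t : KIndex F), c ≠ 0 → f ≠ 0 →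
      kPair k t = tri 1 0 c 0 e f •
        ((tri k x21 x22 x31 x32 x33, tri 1 0 y22 0 y32 y33) : TriPair 3 F) →
      cyclicSubmodule ((tri k x21 x22 x31 x32 x33, tri 1 0 y22 0 y32 y33) : TriPair 3 F) ∈
        kSet k := fun c e f t hc hf h => by
    rw [← cyclicSubmodule_tri_smul one_ne_zero hc hf, ← h]
    exact ⟨t, rfl⟩
  simp only [smul_triPair, tri_mul_tri, Prod.ext_iff] at key
  rcases em (x22 = 0 ∧ y22 = 0) with ⟨rfl, rfl⟩ | h22
  · have hx21 : x21 ≠ 0 := by tauto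
    have h3' := h3 (-x31) x21
    by_cases hy33 : y33 = 0
    · by_cases hx33 : x33 = 0
      · by_cases hx32 : x32 = 0
        · have hy32 : y32 ≠ 0 := by grind
          refine key x21⁻¹ (-(x31 / x21 / y32)) y32⁻¹ .fam4 (by simpa) (by simpa) ?_
          simp only [kPair, tri_inj]
          grind
        · refine key x21⁻¹ (-(x31 / x21 / x32)) x32⁻¹ (.fam3 (y32 / x32)) (by simpa) (by simpa) ?_
          simp only [kPair, tri_inj]
          grind
      · refine key x21⁻¹ (-(x31 / x21 / x33)) x33⁻¹ (.fam2 (x32 / x33) (y32 / x33))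
          (by simpa) (by simpa) ?_
        simp only [kPair, tri_inj]
        grind
    · refine key x21⁻¹ (-(x31 / x21 / y33)) y33⁻¹ (.fam1 (x32 / y33) (x33 / y33) (y32 / y33))
        (by simpa) (by simpa) ?_
      simp only [kPair, tri_inj]
      grind
  · obtain ⟨rfl, rfl⟩ := hu.resolve_left h22
    by_cases hy22 : y22 = 0
    · subst hy22
      have hx22 : x22 ≠ 0 := by tauto
      have h3' := h3 (-x32) x22
      obtain ⟨u, hu⟩ : ∃ u, u = x31 - x32 / x22 * x21 := ⟨_, rfl⟩
      by_cases hy32 : y32 = 0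
      · have hu0 : u ≠ 0 := by grind
        refine key x22⁻¹ (-(x32 / x22 / u)) u⁻¹ (.fam8 (x21 / x22)) (by simpa) (by simpa) ?_
        simp only [kPair, tri_inj]
        grind
      · refine key x22⁻¹ (-(x32 / x22 / y32)) y32⁻¹ (.fam7 (x21 / x22) (u / y32))
          (by simpa) (by simpa) ?_
        simp only [kPair, tri_inj]
        grind
    · have h3' := h3 (-y32) y22
      obtain ⟨u, hu⟩ : ∃ u, u = x31 - y32 / y22 * x21 := ⟨_, rfl⟩
      obtain ⟨v, hv⟩ : ∃ v, v = x32 - y32 / y22 * x22 := ⟨_, rfl⟩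
      by_cases hv0 : v = 0
      · have hu0 : u ≠ 0 := by grind
        refine key y22⁻¹ (-(y32 / y22 / u)) u⁻¹ (.fam6 (x21 / y22) (x22 / y22))
          (by simpa) (by simpa) ?_
        simp only [kPair, tri_inj]
        grind
      · refine key y22⁻¹ (-(y32 / y22 / v)) v⁻¹ (.fam5 (x21 / y22) (x22 / y22) (u / v))
          (by simpa) (by simpa) ?_
        simp only [kPair, tri_inj]
        grind

theorem cyclicSubmodule_mem_firstSet_union {p : TriPair 3 F} (hu : ¬ IsUnimodularPair p)
    (hf : GeneratesFree p) : cyclicSubmodule p ∈ firstSet F ∪ ⋃ k : F, kSet k := by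
  obtain ⟨X, Y⟩ := p
  obtain ⟨x11, x21, x22, x31, x32, x33, rfl⟩ := exists_eq_tri X
  obtain ⟨y11, y21, y22, y31, y32, y33, rfl⟩ := exists_eq_tri Y
  have h1 : ¬ (x11 = 0 ∧ y11 = 0) := fun ⟨h, h'⟩ => by
    subst h h'
    have := generatesFree_iff.1 hf 1 0 0 0 0 0
    simp [tri_mul_tri, tri_zero] at this
  rw [isUnimodularPair_tri] at hu
  by_cases hy : y11 = 0
  · have hx : x11 ≠ 0 := by tauto
    left
    -- The multiplier scales `x11` to 1 and clears the column below it.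
    have hf' := hf.tri_smul (a := x11⁻¹) (b := -(x21 / x11)) (d := -(x31 / x11)) (e := 0)
      (inv_ne_zero hx) one_ne_zero one_ne_zero
    rw [← cyclicSubmodule_tri_smul (a := x11⁻¹) (b := -(x21 / x11)) (d := -(x31 / x11)) (e := 0)
      (inv_ne_zero hx) one_ne_zero one_ne_zero]
    simp only [smul_triPair, tri_mul_tri, inv_mul_cancel₀ hx, div_mul_cancel₀ _ hx, hy, neg_mul,
      one_mul, neg_add_cancel, zero_mul, mul_zero, zero_add, add_zero] at hf' ⊢
    exact exists_firstPair_eq (by tauto) hf'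
  · right
    have hf' := hf.tri_smul (a := y11⁻¹) (b := -(y21 / y11)) (d := -(y31 / y11)) (e := 0)
      (inv_ne_zero hy) one_ne_zero one_ne_zero
    rw [← cyclicSubmodule_tri_smul (a := y11⁻¹) (b := -(y21 / y11)) (d := -(y31 / y11)) (e := 0)
      (inv_ne_zero hy) one_ne_zero one_ne_zero]
    simp only [smul_triPair, tri_mul_tri, inv_mul_cancel₀ hy, div_mul_cancel₀ _ hy, neg_mul,
      one_mul, neg_add_cancel, zero_mul, zero_add, add_zero] at hf' ⊢
    -- The index found by unification is `k = y11⁻¹ * x11`.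
    exact Set.mem_iUnion.2 ⟨_, exists_kPair_eq (by tauto) hf'⟩

theorem outlierFreeSubmodules_eq :
    outlierFreeSubmodules 3 F = firstSet F ∪ ⋃ k : F, kSet k := by
  apply Set.Subset.antisymm
  · intro N hN
    obtain ⟨p, hu, hf, rfl⟩ := mem_outlierFreeSubmodules_iff.1 hN
    exact cyclicSubmodule_mem_firstSet_union hu hf
  · apply Set.union_subset
    · rintro _ ⟨t, rfl⟩
      exact cyclicSubmodule_firstPair_mem t
    · apply Set.iUnion_subset
      rintro k _ ⟨t, rfl⟩
      exact cyclicSubmodule_kPair_mem k t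

end Triangular

/-! ### Counting. -/

/-- The parameters of the eight families as tuples. -/
abbrev FamilyParameters (F : Type*) : Type _ :=
  (F × F × F) ⊕ (F × F) ⊕ F ⊕ Unit ⊕ (F × F × F) ⊕ (F × F) ⊕ (F × F) ⊕ F

/-- The labels of the first set are the parameters of its families. -/
def FirstIndex.equiv (F : Type*) : FirstIndex F ≃ FamilyParameters F where
  toFun
    | .fam1 a b c => .inl (a, b, c)
    | .fam2 a b => .inr (.inl (a, b))
    | .fam3 a => .inr (.inr (.inl a))
    | .fam4 => .inr (.inr (.inr (.inl ())))
    | .fam5 a b c => .inr (.inr (.inr (.inr (.inl (a, b, c)))))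
    | .fam6 a b => .inr (.inr (.inr (.inr (.inr (.inl (a, b))))))
    | .fam7 a b => .inr (.inr (.inr (.inr (.inr (.inr (.inl (a, b)))))))
    | .fam8 a => .inr (.inr (.inr (.inr (.inr (.inr (.inr a))))))
  invFun
    | .inl (a, b, c) => .fam1 a b c
    | .inr (.inl (a, b)) => .fam2 a b
    | .inr (.inr (.inl a)) => .fam3 a
    | .inr (.inr (.inr (.inl _))) => .fam4
    | .inr (.inr (.inr (.inr (.inl (a, b, c))))) => .fam5 a b c
    | .inr (.inr (.inr (.inr (.inr (.inl (a, b)))))) => .fam6 a b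
    | .inr (.inr (.inr (.inr (.inr (.inr (.inl (a, b))))))) => .fam7 a b
    | .inr (.inr (.inr (.inr (.inr (.inr (.inr a)))))) => .fam8 a
  left_inv t := by cases t <;> rfl
  right_inv t := by rcases t with _ | _ | _ | _ | _ | _ | _ | _ <;> rfl

/-- The labels of a `k`-set are the parameters of its families. -/
def KIndex.equivFirstIndex (F : Type*) : KIndex F ≃ FirstIndex F where
  toFun
    | .fam1 a b c => .fam1 a b c
    | .fam2 a b => .fam2 a b
    | .fam3 a => .fam3 a
    | .fam4 => .fam4
    | .fam5 a b c => .fam5 a b c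
    | .fam6 a b => .fam6 a b
    | .fam7 a b => .fam7 a b
    | .fam8 a => .fam8 a
  invFun
    | .fam1 a b c => .fam1 a b c
    | .fam2 a b => .fam2 a b
    | .fam3 a => .fam3 a
    | .fam4 => .fam4
    | .fam5 a b c => .fam5 a b c
    | .fam6 a b => .fam6 a b
    | .fam7 a b => .fam7 a b
    | .fam8 a => .fam8 a
  left_inv t := by cases t <;> rfl
  right_inv t := by cases t <;> rfl

section Counting

variable (F : Type*) [Finite F]

instance FirstIndex.finite : Finite (FirstIndex F) := Finite.of_equiv _ (FirstIndex.equiv F).symm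

instance KIndex.finite : Finite (KIndex F) := Finite.of_equiv _ (KIndex.equivFirstIndex F).symm

/-- The families contribute `2q³ + 3q² + 2q + 1` labels in all, which factors as stated. -/
theorem FirstIndex.natCard :
    Nat.card (FirstIndex F) = (Nat.card F + 1) * (2 * Nat.card F ^ 2 + Nat.card F + 1) := by
  rw [Nat.card_congr (FirstIndex.equiv F)]
  simp only [Nat.card_sum, Nat.card_prod, Nat.card_unique]
  ring

theorem KIndex.natCard :
    Nat.card (KIndex F) = (Nat.card F + 1) * (2 * Nat.card F ^ 2 + Nat.card F + 1) := by
  rw [Nat.card_congr (KIndex.equivFirstIndex F), FirstIndex.natCard]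

variable [Field F]

theorem ncard_firstSet :
    (firstSet F).ncard = (Nat.card F + 1) * (2 * Nat.card F ^ 2 + Nat.card F + 1) := by
  rw [← FirstIndex.natCard, firstSet, ← Nat.card_coe_set_eq,
    Nat.card_range_of_injective cyclicSubmodule_firstPair_injective]

theorem ncard_kSet (k : F) :
    (kSet k).ncard = (Nat.card F + 1) * (2 * Nat.card F ^ 2 + Nat.card F + 1) := by
  rw [← KIndex.natCard, kSet, ← Nat.card_coe_set_eq,
    Nat.card_range_of_injective (cyclicSubmodule_kPair_injective k)]

theorem ncard_outlierFreeSubmodules :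
    (outlierFreeSubmodules 3 F).ncard =
      (Nat.card F + 1) ^ 2 * (2 * Nat.card F ^ 2 + Nat.card F + 1) := by
  have hk : ∀ k : F, (kSet k).Finite := fun k => Set.finite_range _
  rw [outlierFreeSubmodules_eq, Set.ncard_union_eq
    (Set.disjoint_iUnion_right.2 disjoint_firstSet_kSet) (Set.finite_range _)
    (Set.finite_iUnion hk), Set.ncard_iUnion_of_finite hk fun k l => disjoint_kSet_kSet]
  cases nonempty_fintype F
  simp only [ncard_firstSet, ncard_kSet, finsum_eq_sum_of_fintype, Finset.sum_const,
    Finset.card_univ, ← Nat.card_eq_fintype_card, smul_eq_mul]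
  ring

end Counting

theorem mainTheorem6 (F : Type*) [Field F] [Finite F] (q : ℕ) (hq : Nat.card F = q) :
    (outlierFreeSubmodules 3 F).ncard = (q + 1) ^ 2 * (2 * q ^ 2 + q + 1) ∧
    outlierFreeSubmodules 3 F = firstSet F ∪ ⋃ k : F, kSet k ∧
    (∀ k : F, Disjoint (firstSet F) (kSet k)) ∧
    (∀ k l : F, k ≠ l → Disjoint (kSet k) (kSet l)) ∧
    Function.Injective (fun t : FirstIndex F => cyclicSubmodule (firstPair t)) ∧
    (∀ k : F, Function.Injective (fun t : KIndex F => cyclicSubmodule (kPair k t))) := by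
  subst hq
  exact ⟨ncard_outlierFreeSubmodules F, outlierFreeSubmodules_eq, disjoint_firstSet_kSet,
    fun _ _ => disjoint_kSet_kSet, cyclicSubmodule_firstPair_injective,
    cyclicSubmodule_kPair_injective⟩
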